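/- Let $d \ge 0$ be an integer and let $\mathbb{R}^d[t]$ be the space of real univariate polynomials of degree at most $d$. A polynomial $p \in \mathbb{R}^d[t]$ is called real-rooted if it is zero or all its complex roots are real. A nonzero $p \in \mathbb{R}^d[t]$ has a root at $\infty$ of multiplicity $d - \deg p$ (so $\infty$ is a root exactly when $\deg p < d$); the zero polynomial has a root of multiplicity $+\infty$ at every point of $\mathbb{R} \cup \{\infty\}$. A root is simple if its multiplicity is $1$. Let $f = (f_1,\dots,f_n)$ be a finite list of polynomials in $\mathbb{R}^d[t]$ such that (i) $f$ is proper: no convex combination of $f_1,\dots,f_n$ is the zero polynomial; (ii) $f$ is $3$-compatible: every convex combination of at most $3$ of the polynomials $f_1,\dots,f_n$ is real-rooted; (iii) there is no point $r \in \mathbb{R} \cup \{\infty\}$ that is a root of every $f_i$. Put $\bar f = \sum_{i=1}^n f_i$. Then there is $\varepsilon_0 > 0$ such that for all $0 < \varepsilon < \varepsilon_0$ the list $(f_1 + \varepsilon \bar f, \dots, f_n + \varepsilon \bar f)$ is compatible, i.e. every convex combination of it is real-rooted, and moreover every convex combination of it is a nonzero polynomial all of whose roots in $\mathbb{R} \cup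 \{\infty\}$ are simple (in particular its degree is $d$ or $d-1$). -/

import Mathlib

open Polynomial

/-- A real polynomial is real-rooted if it is zero or all of its complex roots are real. -/
def RealRooted (p : ℝ[X]) : Prop :=
  p ≠ 0 → ∀ z : ℂ, aeval z p = 0 → z.im = 0

/-- The convex combination (if `w` lies in the standard simplex) of the list `f` with weights `w`. -/
noncomputable def combo {n : ℕ} (f : Fin n → ℝ[X]) (w : Fin n → ℝ) : ℝ[X] :=
  ∑ i, w i • f i

/-- No convex combination of the list is the zero polynomial. -/
def IsProper {n : ℕ} (f : Fin n → ℝ[X]) : Prop :=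
  ∀ w ∈ stdSimplex ℝ (Fin n), combo f w ≠ 0

/-- Every convex combination of the list is real-rooted. -/
def IsCompatible {n : ℕ} (f : Fin n → ℝ[X]) : Prop :=
  ∀ w ∈ stdSimplex ℝ (Fin n), RealRooted (combo f w)

/-- Every convex combination of at most `k` members of the list is real-rooted. -/
def IsKCompatible (k : ℕ) {n : ℕ} (f : Fin n → ℝ[X]) : Prop :=
  ∀ w ∈ stdSimplex ℝ (Fin n), {i | w i ≠ 0}.ncard ≤ k → RealRooted (combo f w)

/-- The multiplicity of the point `r` of `ℝ ∪ {∞}` as a root of `p`, where `p` is regarded as an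
element of the space of real polynomials of degree at most `d`. It is `0` if `r` is not a root; at
`∞` it is `d - deg p`; the zero polynomial has multiplicity `⊤` everywhere. -/
noncomputable def rootMult (d : ℕ) (p : ℝ[X]) (r : OnePoint ℝ) : ℕ∞ :=
  open Classical in
  if p = 0 then ⊤
  else r.elim ((d - p.natDegree : ℕ) : ℕ∞) (fun x : ℝ => ((p.rootMultiplicity x : ℕ) : ℕ∞))

/-- All roots of `p`, regarded as a polynomial of degree at most `d`, are real (or `∞`) and simple.
In particular `p` is not the zero polynomial. -/
def OnlySimpleRealRoots (d : ℕ) (p : ℝ[X]) : Prop :=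
  RealRooted p ∧ ∀ r : OnePoint ℝ, rootMult d p r ≤ 1

/-! Convex combinations of the perturbed list are combinations of `f` with weights `w i + ε`, all
strictly positive. If one vanished at a nonreal `z`, then `0` would lie in the convex hull of the
values `f i (z)` in the plane; by Carathéodory at most three of them suffice, contradicting
properness and `3`-compatibility (`IsProper.im_eq_zero_of_aeval_combo`). If one had a multiple real
root `x`, choose `i` with `f i (x) ≠ 0`: by `exists_root_add_smul_im_pos` an arbitrarily small
change of the `i`-th weight creates a nonreal root while all weights stay positive, again a
contradiction. The point `∞` is moved to `0` by `reflect d`. -/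

open Complex in
/-- If `p` has a multiple root at a real point `x` which is not a root of `q`, then some
arbitrarily small real multiple of `q`, added to `p`, creates a root in the upper half plane. -/
theorem exists_root_add_smul_im_pos {p q : ℝ[X]} {x : ℝ} (hp : p ≠ 0)
    (hm : 2 ≤ p.rootMultiplicity x) (hq : q.eval x ≠ 0) {η : ℝ} (hη : 0 < η) :
    ∃ z : ℂ, 0 < z.im ∧ ∃ δ : ℝ, |δ| < η ∧ aeval z (p + δ • q) = 0 := by
  obtain ⟨h, hph, hh⟩ := p.exists_eq_pow_rootMultiplicity_mul_and_not_dvd hp x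
  generalize p.rootMultiplicity x = m at hm hph
  have hhx : h.eval x ≠ 0 := fun h0 => hh (dvd_iff_isRoot.2 h0)
  have hm0 : (0 : ℝ) < m := by exact_mod_cast (by omega : 0 < m)
  have hm2 : (2 : ℝ) ≤ m := by exact_mod_cast hm
  have heval (g : ℝ[X]) : aeval (x : ℂ) g = ((g.eval x : ℝ) : ℂ) := by
    simpa using aeval_algebraMap_apply ℂ x g
  let c : ℝ → ℝ → ℂ := fun r θ => x + r * exp (θ * I)
  -- For `r > 0` and `q ≠ 0` at `c r θ`, this is the imaginary part of `p / q` there, up to a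
  -- positive factor. Without the factor `r ^ m` it has a nontrivial limit at `r = 0`.
  let G : ℝ → ℝ → ℝ := fun r θ =>
    (exp (m * θ * I) * aeval (c r θ) h * (starRingEnd ℂ) (aeval (c r θ) q)).im
  have hG : Continuous fun s : ℝ × ℝ => G s.1 s.2 := by
    have hc : Continuous fun s : ℝ × ℝ => c s.1 s.2 := by fun_prop
    have h1 : Continuous fun s : ℝ × ℝ => aeval (c s.1 s.2) h := h.continuous_aeval.comp hc
    have h2 : Continuous fun s : ℝ × ℝ => aeval (c s.1 s.2) q := q.continuous_aeval.comp hc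
    exact continuous_im.comp ((by fun_prop : Continuous fun s : ℝ × ℝ =>
      exp (m * s.2 * I)).mul h1 |>.mul (continuous_conj.comp h2))
  have hG0 (θ : ℝ) : G 0 θ = Real.sin (m * θ) * (h.eval x * q.eval x) := by
    have h1 : (exp (m * θ * I)).im = Real.sin (m * θ) := by
      rw [← exp_ofReal_mul_I_im]; push_cast; rfl
    simp only [G, c, ofReal_zero, zero_mul, add_zero, heval, conj_ofReal, mul_assoc, ← ofReal_mul,
      im_mul_ofReal] at h1 ⊢
    rw [h1]
  -- Multiplicity at least `2` is what makes `3π / (2m) < π`, so that the sign change occurs in the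
  -- open upper half plane.
  obtain ⟨θ₁, θ₂, hθ₁, hθ, hθ₂, hs₁, hs₂⟩ : ∃ θ₁ θ₂ : ℝ, 0 < θ₁ ∧ θ₁ ≤ θ₂ ∧ θ₂ < Real.pi ∧
      Real.sin (m * θ₁) = 1 ∧ Real.sin (m * θ₂) = -1 := by
    have hπ := Real.pi_pos
    refine ⟨Real.pi / 2 / m, (Real.pi / 2 + Real.pi) / m, by positivity, by gcongr; linarith, ?_,
      ?_, ?_⟩
    · rw [div_lt_iff₀ hm0]; nlinarith
    · rw [mul_div_cancel₀ _ hm0.ne', Real.sin_pi_div_two]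
    · rw [mul_div_cancel₀ _ hm0.ne', Real.sin_add_pi, Real.sin_pi_div_two]
  have hneg : ∀ᶠ r in nhds (0 : ℝ), G r θ₁ * G r θ₂ < 0 := by
    have hl (θ : ℝ) : Continuous fun r => G r θ :=
      hG.comp (f := fun r => (r, θ)) (continuous_id.prodMk continuous_const)
    have hc : Continuous fun r => G r θ₁ * G r θ₂ := (hl θ₁).mul (hl θ₂)
    refine hc.continuousAt.eventually_lt continuousAt_const ?_
    rw [hG0, hG0, hs₁, hs₂]
    have := mul_self_pos.2 (mul_ne_zero hhx hq)
    linarith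
  -- Strictness yields both `q ≠ 0` at `z` and the bound on `δ = -p / q`.
  have hsmall : ∀ᶠ z in nhds (x : ℂ), ‖aeval z p‖ < η * ‖aeval z q‖ := by
    refine p.continuous_aeval.norm.continuousAt.eventually_lt
      (continuous_const.mul q.continuous_aeval.norm).continuousAt ?_
    have hp0 : p.eval x = 0 := by
      rw [hph, eval_mul, eval_pow]; simp [show m ≠ 0 by omega]
    rw [heval, heval, hp0, ofReal_zero, norm_zero, norm_real]
    exact mul_pos hη (norm_pos_iff.2 hq)
  obtain ⟨R₁, hR₁, h₁⟩ := Metric.eventually_nhds_iff.1 hneg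
  obtain ⟨R₂, hR₂, h₂⟩ := Metric.eventually_nhds_iff.1 hsmall
  obtain ⟨r, hr0, hr⟩ := exists_between (lt_min hR₁ hR₂)
  have hGr : ContinuousOn (G r) (Set.Icc θ₁ θ₂) :=
    (hG.comp (f := fun θ => (r, θ)) (continuous_const.prodMk continuous_id)).continuousOn
  have hr₁ := h₁ (y := r) (by
    rw [dist_zero_right, Real.norm_of_nonneg hr0.le]; exact hr.trans_le (min_le_left _ _))
  obtain ⟨θ, hmem, hzero⟩ : ∃ θ ∈ Set.Icc θ₁ θ₂, G r θ = 0 := by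
    rcases mul_neg_iff.1 hr₁ with h | h
    · exact intermediate_value_Icc' hθ hGr ⟨h.2.le, h.1.le⟩
    · exact intermediate_value_Icc hθ hGr ⟨h.1.le, h.2.le⟩
  have hz := h₂ (y := c r θ) (by
    simp only [c, dist_eq, add_sub_cancel_left, norm_mul, norm_real, norm_exp_ofReal_mul_I, mul_one,
      Real.norm_of_nonneg hr0.le]
    exact hr.trans_le (min_le_right _ _))
  have hqz : aeval (c r θ) q ≠ 0 := fun h0 => by
    rw [h0, norm_zero, mul_zero] at hz; exact (norm_nonneg _).not_gt hz
  have him : (aeval (c r θ) p / aeval (c r θ) q).im = 0 := by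
    have hpc : aeval (c r θ) p = (r ^ m : ℝ) * (exp (m * θ * I) * aeval (c r θ) h) := by
      conv_lhs => rw [hph]
      have : exp (m * θ * I) = exp (θ * I) ^ m := by rw [← exp_nat_mul]; ring_nf
      rw [this]
      simp [c, mul_pow, mul_assoc]
    rw [div_eq_mul_inv, inv_def, hpc, ← mul_assoc, im_mul_ofReal, mul_assoc, im_ofReal_mul]
    change _ * G r θ * _ = 0
    rw [hzero]; simp
  have hre : ((aeval (c r θ) p / aeval (c r θ) q).re : ℂ) = aeval (c r θ) p / aeval (c r θ) q :=
    Complex.ext (by simp) (by simp [him])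
  refine ⟨c r θ, ?_, -(aeval (c r θ) p / aeval (c r θ) q).re, ?_, ?_⟩
  · have : (c r θ).im = r * Real.sin θ := by
      simp only [c, add_im, ofReal_im, zero_add, im_ofReal_mul, exp_ofReal_mul_I_im]
    rw [this]
    exact mul_pos hr0 (Real.sin_pos_of_pos_of_lt_pi (hθ₁.trans_le hmem.1) (hmem.2.trans_lt hθ₂))
  · rw [abs_neg, ← Real.norm_eq_abs, ← norm_real, hre, norm_div, div_lt_iff₀ (norm_pos_iff.2 hqz)]
    exact hz
  · rw [map_add, neg_smul, map_neg, map_smul, real_smul, hre, div_mul_cancel₀ _ hqz,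
      add_neg_cancel]

theorem aeval_combo {n : ℕ} (f : Fin n → ℝ[X]) (w : Fin n → ℝ) (z : ℂ) :
    aeval z (combo f w) = ∑ i, w i • aeval z (f i) := by
  simp [combo]

theorem combo_add_single {n : ℕ} (f : Fin n → ℝ[X]) (w : Fin n → ℝ) (i : Fin n) (δ : ℝ) :
    combo f (w + Pi.single i δ) = combo f w + δ • f i := by
  simp [combo, add_smul, Finset.sum_add_distrib, Pi.single_apply, ite_smul]

/-- The perturbation pushes weights off the boundary of the simplex into the open orthant. -/
theorem combo_add_smul_sum {n : ℕ} (f : Fin n → ℝ[X]) {w : Fin n → ℝ} (hw : ∑ i, w i = 1)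
    (ε : ℝ) : combo (fun i => f i + ε • ∑ j, f j) w = combo f fun i => w i + ε := by
  simp only [combo, smul_add, add_smul, Finset.sum_add_distrib]
  rw [← Finset.sum_smul, hw, one_smul, Finset.smul_sum]

theorem IsProper.combo_ne_zero {n : ℕ} {f : Fin n → ℝ[X]} (hf : IsProper f) {w : Fin n → ℝ}
    (h0 : ∀ i, 0 ≤ w i) (hs : 0 < ∑ i, w i) : combo f w ≠ 0 := by
  intro h
  refine hf (fun i => (∑ j, w j)⁻¹ * w i) ⟨fun i => by have := h0 i; positivity, ?_⟩ ?_
  · rw [← Finset.mul_sum, inv_mul_cancel₀ hs.ne']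
  · have : combo f (fun i => (∑ j, w j)⁻¹ * w i) = (∑ j, w j)⁻¹ • combo f w := by
      simp [combo, Finset.smul_sum, mul_smul]
    rw [this, h, smul_zero]

/-- By Carathéodory's theorem in the complex plane, conic combinations of a proper `3`-compatible
list have no nonreal roots. -/
theorem IsProper.im_eq_zero_of_aeval_combo {n : ℕ} {f : Fin n → ℝ[X]} (hf : IsProper f)
    (hc : IsKCompatible 3 f) {w : Fin n → ℝ} (h0 : ∀ i, 0 ≤ w i) (hs : 0 < ∑ i, w i) {z : ℂ}
    (hz : aeval z (combo f w) = 0) : z.im = 0 := by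
  have hmem : (0 : ℂ) ∈ convexHull ℝ (Set.range fun i => aeval z (f i)) := by
    have := Finset.centerMass_mem_convexHull Finset.univ (w := w) (z := fun i => aeval z (f i))
      (s := Set.range fun i => aeval z (f i)) (fun i _ => h0 i) hs (fun i _ => ⟨i, rfl⟩)
    rwa [Finset.centerMass, ← aeval_combo, hz, smul_zero] at this
  obtain ⟨ι, _, y, v, hy, hind, hv, hv1, hvy⟩ := eq_pos_convex_span_of_mem_convexHull hmem
  choose g hg using fun j => hy ⟨j, rfl⟩
  have hginj : Function.Injective g := fun a b hab => hind.injective (by rw [← hg, ← hg, hab])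
  -- Affinely independent points in a real plane number at most `2 + 1`.
  have hcard : Fintype.card ι ≤ 3 := by
    have := hind.card_le_finrank_succ
    have h2 := Submodule.finrank_le (vectorSpan ℝ (Set.range y))
    rw [Complex.finrank_real_complex] at h2
    omega
  classical
  let w' : Fin n → ℝ := fun i => ∑ j, if g j = i then v j else 0
  have hw' : w' ∈ stdSimplex ℝ (Fin n) := by
    refine ⟨fun i => Finset.sum_nonneg fun j _ => by split_ifs <;> simp [(hv j).le], ?_⟩
    rw [Finset.sum_comm]; simpa using hv1
  have hsupp : {i | w' i ≠ 0}.ncard ≤ 3 := by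
    refine le_trans ?_ hcard
    rw [← Nat.card_eq_fintype_card, ← Set.ncard_univ, ← Set.ncard_image_of_injective _ hginj]
    refine Set.ncard_le_ncard (fun i hi => ?_) (Set.toFinite _)
    obtain ⟨j, -, hj⟩ := Finset.exists_ne_zero_of_sum_ne_zero hi
    exact ⟨j, trivial, by_contra fun h => hj (if_neg h)⟩
  refine hc w' hw' hsupp (hf w' hw') z ?_
  simp only [aeval_combo, w', Finset.sum_smul, ite_smul, zero_smul]
  rw [Finset.sum_comm]
  simpa [hg] using hvy

/-- A positive combination of a proper `3`-compatible list has no multiple root at a point which is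
not a common root of the list. -/
theorem IsProper.rootMultiplicity_combo_le_one {n : ℕ} {f : Fin n → ℝ[X]} (hf : IsProper f)
    (hc : IsKCompatible 3 f) {w : Fin n → ℝ} (hw : ∀ i, 0 < w i) {i : Fin n} {x : ℝ}
    (hx : (f i).eval x ≠ 0) : (combo f w).rootMultiplicity x ≤ 1 := by
  have hs : 0 < ∑ i, w i := Finset.sum_pos (fun i _ => hw i) ⟨i, Finset.mem_univ i⟩
  by_contra! h
  -- The bound `|δ| < w i` keeps the `i`-th weight positive.
  obtain ⟨z, hz, δ, hδ, hroot⟩ := exists_root_add_smul_im_pos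
    (hf.combo_ne_zero (fun i => (hw i).le) hs) h hx (hw i)
  rw [← combo_add_single f w i δ] at hroot
  have hpos : ∀ j, 0 < (w + Pi.single i δ : Fin n → ℝ) j := by
    intro j
    by_cases hj : j = i
    · subst hj; simp; linarith [(abs_lt.1 hδ).1]
    · simp [hj, hw j]
  exact hz.ne' (hf.im_eq_zero_of_aeval_combo hc (fun j => (hpos j).le)
    (Finset.sum_pos (fun j _ => hpos j) ⟨i, Finset.mem_univ i⟩) hroot)

theorem reflect_combo {n : ℕ} (d : ℕ) (f : Fin n → ℝ[X]) (w : Fin n → ℝ) :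
    reflect d (combo f w) = combo (fun i => reflect d (f i)) w := by
  ext k
  simp [combo, coeff_reflect]

theorem natDegree_combo_le {n d : ℕ} {f : Fin n → ℝ[X]} (hdeg : ∀ i, (f i).natDegree ≤ d)
    (w : Fin n → ℝ) : (combo f w).natDegree ≤ d :=
  natDegree_sum_le_of_forall_le _ _ fun i _ => (natDegree_smul_le _ _).trans (hdeg i)

/-- Nonzero roots of the reflection are inverses of roots of `p`. -/
theorem RealRooted.reflect {p : ℝ[X]} {d : ℕ} (hp : RealRooted p) (hd : p.natDegree ≤ d) :
    RealRooted (reflect d p) := by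
  intro h0 z hz
  by_cases hz0 : z = 0
  · simp [hz0]
  let := invertibleOfNonzero (inv_ne_zero hz0)
  have h := eval₂_reflect_eq_zero_iff (algebraMap ℝ ℂ) z⁻¹ d p hd
  rw [invOf_eq_inv, inv_inv] at h
  have him := hp (by rintro rfl; simp at h0) z⁻¹ (h.1 hz)
  simpa [hz0] using him

theorem IsProper.reflect {n : ℕ} {f : Fin n → ℝ[X]} (hf : IsProper f) (d : ℕ) :
    IsProper fun i => reflect d (f i) := by
  intro w hw
  rw [← reflect_combo, Ne, reflect_eq_zero_iff]
  exact hf w hw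

theorem IsKCompatible.reflect {k n d : ℕ} {f : Fin n → ℝ[X]} (hc : IsKCompatible k f)
    (hdeg : ∀ i, (f i).natDegree ≤ d) : IsKCompatible k fun i => reflect d (f i) := by
  intro w hw hk
  rw [← reflect_combo]
  exact (hc w hw hk).reflect (natDegree_combo_le hdeg w)

theorem theorem4p4 (d n : ℕ) (f : Fin n → ℝ[X])
    (hdeg : ∀ i, (f i).natDegree ≤ d)
    (hproper : IsProper f)
    (hcompat : IsKCompatible 3 f)
    (hroot : ¬ ∃ r : OnePoint ℝ, ∀ i, 1 ≤ rootMult d (f i) r) :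
    ∃ ε₀ : ℝ, 0 < ε₀ ∧ ∀ ε : ℝ, 0 < ε → ε < ε₀ →
      IsCompatible (fun i => f i + ε • ∑ j, f j) ∧
      ∀ w ∈ stdSimplex ℝ (Fin n),
        OnlySimpleRealRoots d (combo (fun i => f i + ε • ∑ j, f j) w) := by
  -- Every `ε > 0` works; the bound `1` is arbitrary.
  refine ⟨1, one_pos, fun ε hε _ => ?_⟩
  have hpos {w : Fin n → ℝ} (hw : w ∈ stdSimplex ℝ (Fin n)) (i : Fin n) : 0 < w i + ε :=
    add_pos_of_nonneg_of_pos (hw.1 i) hε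
  have hsum {w : Fin n → ℝ} (hw : w ∈ stdSimplex ℝ (Fin n)) : 0 < ∑ i, (w i + ε) := by
    rw [Finset.sum_add_distrib, hw.2]
    have : 0 ≤ ∑ _i : Fin n, ε := Finset.sum_nonneg fun _ _ => hε.le
    linarith
  have hreal : IsCompatible fun i => f i + ε • ∑ j, f j := fun w hw _ z hz => by
    rw [combo_add_smul_sum f hw.2] at hz
    exact hproper.im_eq_zero_of_aeval_combo hcompat (fun i => (hpos hw i).le) (hsum hw) hz
  refine ⟨hreal, fun w hw => ⟨hreal w hw, fun r => ?_⟩⟩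
  rw [combo_add_smul_sum f hw.2]
  have hne := hproper.combo_ne_zero (fun i => (hpos hw i).le) (hsum hw)
  push Not at hroot
  obtain ⟨i, hi⟩ := hroot r
  have hi0 : f i ≠ 0 := fun h => by simp [rootMult, h] at hi
  rw [Order.lt_one_iff, rootMult, if_neg hi0] at hi
  rw [rootMult, if_neg hne]
  induction r using OnePoint.rec with
  | coe x =>
    simp only [OnePoint.elim_some, Nat.cast_eq_zero] at hi ⊢
    have hx : (f i).eval x ≠ 0 := fun h => (rootMultiplicity_pos hi0).2 h |>.ne' hi
    exact_mod_cast hproper.rootMultiplicity_combo_le_one hcompat (hpos hw) hx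
  | infty =>
    simp only [OnePoint.elim_infty, Nat.cast_eq_zero] at hi ⊢
    set p := combo f fun i => w i + ε with hp
    -- With `hdeg`, the truncated difference in `hi` being `0` forces `f i` to have degree exactly
    -- `d`.
    have hx : (reflect d (f i)).eval 0 ≠ 0 := by
      rw [← coeff_zero_eq_eval_zero, coeff_reflect, revAt_le (Nat.zero_le d), Nat.sub_zero,
        (by have := hdeg i; omega : d = (f i).natDegree)]
      exact leadingCoeff_ne_zero.2 hi0
    have hle := (hproper.reflect d).rootMultiplicity_combo_le_one (hcompat.reflect hdeg)
      (hpos hw) hx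
    rw [← reflect_combo, ← hp] at hle
    -- A degree drop of at least `2` kills the two lowest coefficients of the reflection, making `0`
    -- a double root.
    refine Nat.cast_le_one.2 (not_lt.1 fun hlt => hle.not_gt ?_)
    change 2 ≤ _
    rw [le_rootMultiplicity_iff (by rwa [Ne, reflect_eq_zero_iff]), C_0, sub_zero, X_pow_dvd_iff]
    intro k hk
    rw [coeff_reflect, revAt_le (by omega)]
    exact coeff_eq_zero_of_natDegree_lt (by omega)
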